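/- Let $k \ge 2$ and $m \ge 0$ be integers. A (complete) matching of $[2m]=\{1,\dots,2m\}$ is a partition of $[2m]$ into blocks of size two; a block $\{i,j\}$ with $i<j$ is called an arc and written $(i,j)$. A $k$-crossing of a matching is a set of $k$ arcs $(i_1,j_1),\dots,(i_k,j_k)$ of it with $i_1<i_2<\cdots<i_k<j_1<j_2<\cdots<j_k$, and a matching is $k$-noncrossing if it has no $k$-crossing. Then the number of $k$-noncrossing matchings of $[2m]$ is equal to the number of lattice walks of length $2m$ from the origin to itself that stay in the set $$V_k=\{(a_1,a_2,\dots,a_{k-1})\in\mathbb{Z}^{k-1} : a_1\ge a_2\ge\cdots\ge a_{k-1}\ge 0\}$$ and all of whose steps are of the form $\pm\epsilon_i$ with $1\le i\le k-1$, where $\epsilon_i$ is the $i$-th unit coordinate vector. -/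

import Mathlib

/-- The complete matchings of `[n] = {1, …, n}`: the set partitions of `{1, …, n}`
all of whose blocks have exactly two elements. -/
def completeMatchings (n : ℕ) : Set (Finpartition (Finset.Icc 1 n)) :=
  {M | ∀ B ∈ M.parts, B.card = 2}

/-- `(i, j)` is an arc of the partition `M`: `{i, j}` is a block of `M` and `i < j`. -/
def IsArc {n : ℕ} (M : Finpartition (Finset.Icc 1 n)) (i j : ℕ) : Prop :=
  i < j ∧ ({i, j} : Finset ℕ) ∈ M.parts

/-- `M` has a `k`-crossing: there are `k` arcs `(i₁, j₁), …, (iₖ, jₖ)` of `M` with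
`i₁ < i₂ < ⋯ < iₖ < j₁ < j₂ < ⋯ < jₖ`. -/
def HasCrossing {n : ℕ} (k : ℕ) (M : Finpartition (Finset.Icc 1 n)) : Prop :=
  ∃ i j : Fin k → ℕ, (∀ r, IsArc M (i r) (j r)) ∧
    StrictMono i ∧ StrictMono j ∧ ∀ r s, i r < j s

/-- The `k`-noncrossing complete matchings of `[n]`. -/
def noncrossingMatchings (k n : ℕ) : Set (Finpartition (Finset.Icc 1 n)) :=
  {M | M ∈ completeMatchings n ∧ ¬ HasCrossing k M}

/-- The chamber `{(a₁, …, a_d) ∈ ℤ^d : a₁ ≥ a₂ ≥ ⋯ ≥ a_d ≥ 0}`. -/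
def chamber (d : ℕ) : Set (Fin d → ℤ) :=
  {a | Antitone a ∧ ∀ i, 0 ≤ a i}

/-- `v` is a unit step: `v = ε_c` or `v = -ε_c` for some coordinate `c`. -/
def IsUnitStep {d : ℕ} (v : Fin d → ℤ) : Prop :=
  ∃ c : Fin d, v = Pi.single c 1 ∨ v = -Pi.single c 1

/-- The lattice walks `w₀, w₁, …, w_n` of length `n` from the origin to itself that stay in the
chamber of `ℤ^d` and use only unit steps. -/
def closedChamberWalks (d n : ℕ) : Set (Fin (n + 1) → Fin d → ℤ) :=
  {w | w 0 = 0 ∧ w (Fin.last n) = 0 ∧ (∀ t, w t ∈ chamber d) ∧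
    ∀ t : Fin n, IsUnitStep (w t.succ - w t.castSucc)}

/-! The bijection is the Robinson-Schensted correspondence in Viennot's geometric form, applied to
every initial segment of the matching at once. The arc `(i, j)` is drawn as the cell `(i - 1, n -
j)` of a triangle, so the rectangle `[0, t) × [0, n - t)` holds exactly the arcs with `i ≤ t < j`,
those open at time `t`. Their Robinson-Schensted shape gains a box when `t + 1` opens an arc and
loses one when it closes an arc. The first row of the shape is the number of shadow lines; each
further row is the shadow count of the next iterated skeleton. The walk lists these row lengths.

Three facts carry the proof. Increments of the shadow count are row or column sums of the filling
minus those of its skeleton (`shadowCount_increments`). Hence each point of a complete matching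
moves exactly one coordinate by one, once all the remaining skeletons are empty (`coverage_eq_sum`).
Passing to the skeleton shortens crossings by one (`hasCrossing_skeleton_iff`), so the absence of
`(d + 1)`-crossings means that the `d`-th skeleton is empty and `d` coordinates suffice. A filling
is determined by its skeleton and its boundary shadow counts (`eq_of_skeleton_eq`), and all
compatible data occur (`exists_skeleton_eq`). Induction on the number of coordinates then inverts
the map. -/

/-- The number of Viennot shadow lines of the filling `x` crossing the rectangle
`[0, p) × [0, q)`. -/
def shadowCount (x : ℕ → ℕ → ℕ) : ℕ → ℕ → ℕ
  | 0, _ => 0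
  | _ + 1, 0 => 0
  | p + 1, q + 1 => max (shadowCount x p (q + 1)) (shadowCount x (p + 1) q) + x p q

/-- The skeleton of a filling of the triangle `p + q + 2 ≤ n`: the cells at which two shadow
lines meet. -/
def skeleton (n : ℕ) (x : ℕ → ℕ → ℕ) (p q : ℕ) : ℕ :=
  if p + q + 2 ≤ n then
    min (shadowCount x p (q + 1)) (shadowCount x (p + 1) q) - shadowCount x p q
  else 0

/-- The partial sums of the rows of a filling. -/
def rowSum (x : ℕ → ℕ → ℕ) (p q : ℕ) : ℕ := ∑ j ∈ Finset.range q, x p j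

/-- The partial sums of the columns of a filling. -/
def colSum (x : ℕ → ℕ → ℕ) (p q : ℕ) : ℕ := ∑ i ∈ Finset.range p, x i q

/-- The number of arcs that cover the point `p + 1`, when the cell `(p, q)` stands for the arc
`(p + 1, n - q)`. -/
def coverage (n : ℕ) (x : ℕ → ℕ → ℕ) (p : ℕ) : ℕ :=
  rowSum x p (n - 1 - p) + colSum x p (n - 1 - p)

/-- Fillings of the triangle `p + q + 2 ≤ n` that encode partial matchings of `n` points. -/
structure IsPartialMatching (n : ℕ) (x : ℕ → ℕ → ℕ) : Prop where
  support : ∀ p q, n < p + q + 2 → x p q = 0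
  coverage_le : ∀ p < n, coverage n x p ≤ 1

/-! ### Row sums, column sums and shadow counts. -/

section sums

variable (x : ℕ → ℕ → ℕ)

@[simp] lemma rowSum_zero (p : ℕ) : rowSum x p 0 = 0 := rfl

@[simp] lemma colSum_zero (q : ℕ) : colSum x 0 q = 0 := rfl

lemma rowSum_succ (p q : ℕ) : rowSum x p (q + 1) = rowSum x p q + x p q :=
  Finset.sum_range_succ _ _

lemma colSum_succ (p q : ℕ) : colSum x (p + 1) q = colSum x p q + x p q :=
  Finset.sum_range_succ _ _

lemma rowSum_mono (p : ℕ) : Monotone (rowSum x p) :=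
  monotone_nat_of_le_succ fun q => by rw [rowSum_succ]; omega

lemma colSum_mono (q : ℕ) : Monotone fun p => colSum x p q :=
  monotone_nat_of_le_succ fun p => by simp only [colSum_succ]; omega

lemma le_rowSum {p q r : ℕ} (h : q < r) : x p q ≤ rowSum x p r := by
  have := rowSum_mono x p (Nat.succ_le_of_lt h)
  rw [Nat.succ_eq_add_one, rowSum_succ] at this
  omega

lemma le_colSum {p q r : ℕ} (h : p < r) : x p q ≤ colSum x r q := by
  have := colSum_mono x q (Nat.succ_le_of_lt h)
  simp only [Nat.succ_eq_add_one, colSum_succ] at this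
  omega

/-- A partial row sum that jumps has a nonzero cell in between. -/
lemma exists_of_rowSum_lt {p q r : ℕ} (h : rowSum x p q < rowSum x p r) :
    ∃ j, q ≤ j ∧ j < r ∧ x p j ≠ 0 := by
  by_contra! hc
  have hqr : q ≤ r := by
    by_contra hlt
    have := rowSum_mono x p (not_le.1 hlt).le
    omega
  have : rowSum x p r = rowSum x p q := by
    induction r, hqr using Nat.le_induction with
    | base => rfl
    | succ r hr ih =>
      have hx := hc r hr (Nat.lt_succ_self r)
      rw [rowSum_succ, hx] at h ⊢
      exact ih h fun j h1 h2 => hc j h1 (by omega)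
  omega

/-- A partial column sum that jumps has a nonzero cell in between. -/
lemma exists_of_colSum_lt {p q r : ℕ} (h : colSum x p q < colSum x r q) :
    ∃ i, p ≤ i ∧ i < r ∧ x i q ≠ 0 :=
  exists_of_rowSum_lt (fun a b => x b a) (p := q) h

@[simp] lemma shadowCount_zero_left (q : ℕ) : shadowCount x 0 q = 0 := by
  rw [shadowCount]

@[simp] lemma shadowCount_zero_right (p : ℕ) : shadowCount x p 0 = 0 := by
  cases p <;> rw [shadowCount]

lemma shadowCount_succ (p q : ℕ) : shadowCount x (p + 1) (q + 1) =
    max (shadowCount x p (q + 1)) (shadowCount x (p + 1) q) + x p q := by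
  rw [shadowCount]

end sums

/-! ### Shadow lines and skeletons of partial matchings. -/

namespace IsPartialMatching

variable {n : ℕ} {x : ℕ → ℕ → ℕ}

lemma rowSum_le (hx : IsPartialMatching n x) {p q : ℕ} (h : p + q + 1 ≤ n) :
    rowSum x p q ≤ 1 := by
  have h1 := hx.coverage_le p (by omega)
  have h2 := rowSum_mono x p (show q ≤ n - 1 - p by omega)
  unfold coverage at h1
  omega

lemma colSum_le (hx : IsPartialMatching n x) {p q : ℕ} (h : p + q + 1 ≤ n) :
    colSum x p q ≤ 1 := by
  have h1 := hx.coverage_le (n - 1 - q) (by omega)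
  have h2 := colSum_mono x q (show p ≤ n - 1 - q by omega)
  unfold coverage at h1
  rw [show n - 1 - (n - 1 - q) = q by omega] at h1
  simp only at h2
  omega

/-- Along a row (column), the increment of the shadow count and the number of skeleton cells passed
add up to the number of cells of the filling passed. -/
lemma shadowCount_increments (hx : IsPartialMatching n x) {p q : ℕ} (h : p + q + 1 ≤ n) :
    (shadowCount x p q ≤ shadowCount x (p + 1) q ∧
      shadowCount x (p + 1) q + rowSum (skeleton n x) p q = shadowCount x p q + rowSum x p q) ∧
    (shadowCount x p q ≤ shadowCount x p (q + 1) ∧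
      shadowCount x p (q + 1) + colSum (skeleton n x) p q = shadowCount x p q + colSum x p q) := by
  induction hs : p + q generalizing p q with
  | zero =>
    obtain ⟨rfl, rfl⟩ : p = 0 ∧ q = 0 := by omega
    simp
  | succ s ih =>
    constructor
    · cases q with
      | zero => simp
      | succ q =>
        -- Let `a` and `c` be the row and column increments entering the cell `(p, q)`. The row
        -- increment leaving it is `max a c + x p q - c`, which is `a + x p q - min a c`, and `min a
        -- c` is the skeleton entry.
        obtain ⟨⟨h1, h2⟩, h3, h4⟩ := ih (p := p) (q := q) (by omega) (by omega)
        have h5 := hx.rowSum_le (p := p) (q := q + 1) (by omega)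
        have h6 := hx.colSum_le (p := p + 1) (q := q) (by omega)
        have h7 : skeleton n x p q = _ := if_pos (by omega)
        rw [rowSum_succ] at h5 ⊢
        rw [colSum_succ] at h6
        rw [rowSum_succ, shadowCount_succ]
        omega
    · cases p with
      | zero => simp
      | succ p =>
        obtain ⟨⟨h1, h2⟩, h3, h4⟩ := ih (p := p) (q := q) (by omega) (by omega)
        have h5 := hx.rowSum_le (p := p) (q := q + 1) (by omega)
        have h6 := hx.colSum_le (p := p + 1) (q := q) (by omega)
        have h7 : skeleton n x p q = _ := if_pos (by omega)
        rw [rowSum_succ] at h5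
        rw [colSum_succ] at h6 ⊢
        rw [colSum_succ, shadowCount_succ]
        omega

/-- The points covered by `x` are those covered by its skeleton and those at which the boundary
value of the shadow count changes. -/
lemma coverage_eq (hx : IsPartialMatching n x) {p : ℕ} (hp : p < n) :
    coverage n x p = coverage n (skeleton n x) p +
      Nat.dist (shadowCount x p (n - p)) (shadowCount x (p + 1) (n - (p + 1))) := by
  -- Both boundary corners are neighbours of `(p, n - 1 - p)`. Since the coverage is at most one, at
  -- most one of the two increments from there is nonzero, so their sum is the distance.
  have h1 := hx.shadowCount_increments (p := p) (q := n - 1 - p) (by omega)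
  have h2 := hx.coverage_le p hp
  unfold coverage Nat.dist at *
  rw [show n - 1 - p + 1 = n - p by omega] at h1
  rw [show n - (p + 1) = n - 1 - p by omega]
  omega

lemma isPartialMatching_skeleton (hx : IsPartialMatching n x) :
    IsPartialMatching n (skeleton n x) where
  support p q h := if_neg (by omega)
  coverage_le p hp := by
    have := hx.coverage_eq hp
    have := hx.coverage_le p hp
    omega

lemma isPartialMatching_iterate_skeleton (hx : IsPartialMatching n x) (r : ℕ) :
    IsPartialMatching n ((skeleton n)^[r] x) := by
  induction r with
  | zero => exact hx
  | succ r ih => rw [Function.iterate_succ_apply']; exact ih.isPartialMatching_skeleton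

/-- This is the inequality between consecutive rows of the shape, hence the chamber condition. A
skeleton cell raises the skeleton's count by one only where both entering increments of the
filling's own count are already positive. -/
lemma shadowCount_skeleton_le (hx : IsPartialMatching n x) {p q : ℕ} (h : p + q ≤ n) :
    shadowCount (skeleton n x) p q ≤ shadowCount x p q := by
  induction p generalizing q with
  | zero => simp
  | succ p ihp =>
    induction q with
    | zero => simp
    | succ q ihq =>
      have h1 := hx.shadowCount_increments (p := p) (q := q) (by omega)
      have h2 := hx.isPartialMatching_skeleton.shadowCount_increments (p := p) (q := q) (by omega)
      have h3 := hx.isPartialMatching_skeleton.rowSum_le (p := p) (q := q + 1) (by omega)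
      have h4 := hx.isPartialMatching_skeleton.colSum_le (p := p + 1) (q := q) (by omega)
      have h5 := @ihp (q + 1) (by omega)
      have h6 := ihq (by omega)
      have h7 := @ihp q (by omega)
      have h8 : skeleton n x p q = _ := if_pos (by omega)
      rw [rowSum_succ] at h3
      rw [colSum_succ] at h4
      rw [shadowCount_succ, shadowCount_succ]
      omega

/-- A filling is determined by its skeleton and the boundary values of its shadow count. -/
lemma eq_of_skeleton_eq {y : ℕ → ℕ → ℕ} (hx : IsPartialMatching n x) (hy : IsPartialMatching n y)
    (hs : skeleton n x = skeleton n y)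
    (hb : ∀ t ≤ n, shadowCount x t (n - t) = shadowCount y t (n - t)) : x = y := by
  have key : ∀ l p q, p + q + l = n → shadowCount x p q = shadowCount y p q := by
    intro l
    induction l with
    | zero =>
      intro p q h
      have := hb p (by omega)
      rwa [show n - p = q by omega] at this
    | succ l ih =>
      intro p q h
      have e1 := ih (p + 1) q (by omega)
      have e2 := ih p (q + 1) (by omega)
      have h1 := hx.shadowCount_increments (p := p) (q := q) (by omega)
      have h2 := hy.shadowCount_increments (p := p) (q := q) (by omega)
      have h3 := congrFun (congrFun hs p) q
      -- For `l = 0` the cell lies just outside the triangle, where the skeleton is zero by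
      -- definition. The coverage bound replaces it: one of the two increments vanishes, so the
      -- count is still the minimum of its neighbours.
      rcases Nat.eq_zero_or_pos l with rfl | hl
      · have c1 := hx.coverage_le p (by omega)
        have c2 := hy.coverage_le p (by omega)
        unfold coverage at c1 c2
        rw [show n - 1 - p = q by omega] at c1 c2
        omega
      · have h4 : skeleton n x p q = _ := if_pos (by omega)
        have h5 : skeleton n y p q = _ := if_pos (by omega)
        omega
  funext p q
  by_cases h : p + q + 2 ≤ n
  · have e1 := key (n - (p + q + 1)) (p + 1) q (by omega)
    have e2 := key (n - (p + q + 1)) p (q + 1) (by omega)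
    have e3 := key (n - (p + q + 2)) (p + 1) (q + 1) (by omega)
    rw [shadowCount_succ, shadowCount_succ] at e3
    omega
  · rw [hx.support p q (by omega), hy.support p q (by omega)]

end IsPartialMatching

/-! ### Reconstructing a filling from its skeleton and boundary values. -/

/-- The shadow counts reconstructed from their boundary values `b` and a skeleton `y`, as a
function of the distance to the boundary and the row. -/
def boundaryExtension (n : ℕ) (y : ℕ → ℕ → ℕ) (b : ℕ → ℕ) : ℕ → ℕ → ℕ
  | 0, p => b p
  | l + 1, p => min (boundaryExtension n y b l p) (boundaryExtension n y b l (p + 1)) -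
      y p (n - (l + 1) - p)

/-- The shadow count at the corner `(p, q)` reconstructed from boundary values and a skeleton. -/
def extendedCount (n : ℕ) (y : ℕ → ℕ → ℕ) (b : ℕ → ℕ) (p q : ℕ) : ℕ :=
  boundaryExtension n y b (n - (p + q)) p

/-- The filling reconstructed from boundary values and a skeleton. -/
def extendedFilling (n : ℕ) (y : ℕ → ℕ → ℕ) (b : ℕ → ℕ) (p q : ℕ) : ℕ :=
  if p + q + 2 ≤ n then extendedCount n y b (p + 1) (q + 1) -
    max (extendedCount n y b p (q + 1)) (extendedCount n y b (p + 1) q) else 0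

section extension

variable {n : ℕ} {y : ℕ → ℕ → ℕ} {b : ℕ → ℕ}

lemma extendedCount_boundary {p q : ℕ} (h : p + q = n) : extendedCount n y b p q = b p := by
  rw [extendedCount, show n - (p + q) = 0 by omega, boundaryExtension]

lemma extendedCount_eq {p q : ℕ} (h : p + q < n) : extendedCount n y b p q =
    min (extendedCount n y b p (q + 1)) (extendedCount n y b (p + 1) q) - y p q := by
  unfold extendedCount
  obtain ⟨l, rfl⟩ : ∃ l, n = p + q + l + 1 := ⟨n - (p + q + 1), by omega⟩
  rw [show p + q + l + 1 - (p + q) = l + 1 by omega, boundaryExtension,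
    show p + q + l + 1 - (p + (q + 1)) = l by omega,
    show p + q + l + 1 - (p + 1 + q) = l by omega,
    show p + q + l + 1 - (l + 1) - p = q by omega]

variable (hy : IsPartialMatching n y)
  (hb : ∀ p < n, Nat.dist (b p) (b (p + 1)) + coverage n y p ≤ 1)
  (hyb : ∀ p ≤ n, shadowCount y p (n - p) ≤ b p)

include hy hb hyb

/-- The invariant `shadowCount y ≤ extendedCount`, propagated inward from the boundary, guarantees
that the subtraction in `boundaryExtension` never truncates: a skeleton cell always finds a positive
count to lower. -/
lemma extendedCount_bounds (l p q : ℕ) (h : p + q + l = n) :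
    shadowCount y p q ≤ extendedCount n y b p q ∧
    (l ≠ 0 →
      extendedCount n y b p q + y p q =
        min (extendedCount n y b p (q + 1)) (extendedCount n y b (p + 1) q) ∧
      extendedCount n y b (p + 1) q + rowSum y p q ≤ extendedCount n y b p q + 1 ∧
      extendedCount n y b p (q + 1) + colSum y p q ≤ extendedCount n y b p q + 1) := by
  induction l using Nat.strong_induction_on generalizing p q with
  | _ l ih =>
  match l with
  | 0 =>
    refine ⟨?_, fun h0 => absurd rfl h0⟩
    have := hyb p (by omega)
    rwa [extendedCount_boundary (by omega), show q = n - p by omega]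
  | 1 =>
    have e1 := ih 0 (by omega) p (q + 1) (by omega)
    have e2 := ih 0 (by omega) (p + 1) q (by omega)
    have h1 := hy.support p q (by omega)
    have h2 := hb p (by omega)
    have h3 := extendedCount_eq (n := n) (y := y) (b := b) (p := p) (q := q) (by omega)
    have h4 := hy.shadowCount_increments (p := p) (q := q) (by omega)
    have h5 := extendedCount_boundary (n := n) (y := y) (b := b) (p := p) (q := q + 1) (by omega)
    have h6 := extendedCount_boundary (n := n) (y := y) (b := b) (p := p + 1) (q := q) (by omega)
    unfold coverage Nat.dist at h2
    rw [show n - 1 - p = q by omega] at h2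
    omega
  | l + 2 =>
    obtain ⟨e1, e1'⟩ := ih (l + 1) (by omega) p (q + 1) (by omega)
    obtain ⟨e2, e2'⟩ := ih (l + 1) (by omega) (p + 1) q (by omega)
    have e3 := (ih l (by omega) (p + 1) (q + 1) (by omega)).1
    replace e1' := e1' (by omega)
    replace e2' := e2' (by omega)
    have h3 := extendedCount_eq (n := n) (y := y) (b := b) (p := p) (q := q) (by omega)
    have h4 := hy.shadowCount_increments (p := p) (q := q) (by omega)
    rw [shadowCount_succ] at e3
    rw [rowSum_succ] at e1'
    rw [colSum_succ] at e2'
    omega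

lemma extendedCount_steps {p q : ℕ} (h : p + q < n) :
    extendedCount n y b p q + y p q =
        min (extendedCount n y b p (q + 1)) (extendedCount n y b (p + 1) q) ∧
      extendedCount n y b (p + 1) q + rowSum y p q ≤ extendedCount n y b p q + 1 ∧
      extendedCount n y b p (q + 1) + colSum y p q ≤ extendedCount n y b p q + 1 :=
  (extendedCount_bounds hy hb hyb (n - (p + q)) p q (by omega)).2 (by omega)

lemma extendedCount_zero (h0 : b 0 = 0) (hn : b n = 0) {p q : ℕ} (h : p + q ≤ n)
    (hpq : p = 0 ∨ q = 0) : extendedCount n y b p q = 0 := by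
  induction hl : n - (p + q) generalizing p q with
  | zero =>
    rw [extendedCount_boundary (by omega)]
    rcases hpq with rfl | rfl
    · exact h0
    · rwa [show p = n by omega]
  | succ l ih =>
    have h1 := (extendedCount_steps hy hb hyb (p := p) (q := q) (by omega)).1
    rcases hpq with rfl | rfl
    · have := @ih 0 (q + 1) (by omega) (by omega) (by omega)
      omega
    · have := @ih (p + 1) 0 (by omega) (by omega) (by omega)
      omega

lemma shadowCount_extendedFilling (h0 : b 0 = 0) (hn : b n = 0) {p q : ℕ} (h : p + q ≤ n) :
    shadowCount (extendedFilling n y b) p q = extendedCount n y b p q := by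
  induction p generalizing q with
  | zero => simp [extendedCount_zero hy hb hyb h0 hn h]
  | succ p ihp =>
    induction q with
    | zero => simp [extendedCount_zero hy hb hyb h0 hn h]
    | succ q ihq =>
      have h1 := (extendedCount_steps hy hb hyb (p := p) (q := q + 1) (by omega)).1
      have h2 := (extendedCount_steps hy hb hyb (p := p + 1) (q := q) (by omega)).1
      have h3 : extendedFilling n y b p q = _ := if_pos (by omega)
      rw [shadowCount_succ, ihp (by omega), ihq (by omega), h3]
      omega

lemma skeleton_extendedFilling (h0 : b 0 = 0) (hn : b n = 0) :
    skeleton n (extendedFilling n y b) = y := by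
  funext p q
  unfold skeleton
  split_ifs with h
  · rw [shadowCount_extendedFilling hy hb hyb h0 hn (by omega),
      shadowCount_extendedFilling hy hb hyb h0 hn (by omega),
      shadowCount_extendedFilling hy hb hyb h0 hn (by omega)]
    have := (extendedCount_steps hy hb hyb (p := p) (q := q) (by omega)).1
    omega
  · exact (hy.support p q (by omega)).symm

/-- The conservation law of `shadowCount_increments`, derived here from the reconstructed counts
because `extendedFilling` is not yet known to be a partial matching. -/
lemma extendedFilling_sums (h0 : b 0 = 0) (hn : b n = 0) {p q : ℕ} (h : p + q < n) :
    extendedCount n y b (p + 1) q + rowSum y p q =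
        extendedCount n y b p q + rowSum (extendedFilling n y b) p q ∧
      extendedCount n y b p (q + 1) + colSum y p q =
        extendedCount n y b p q + colSum (extendedFilling n y b) p q := by
  induction hs : p + q generalizing p q with
  | zero =>
    obtain ⟨rfl, rfl⟩ : p = 0 ∧ q = 0 := by omega
    simp [extendedCount_zero hy hb hyb h0 hn]
    constructor <;> (repeat rw [extendedCount_zero hy hb hyb h0 hn (by omega) (by omega)])
  | succ s ih =>
    constructor
    · cases q with
      | zero =>
        simp only [rowSum_zero]
        repeat rw [extendedCount_zero hy hb hyb h0 hn (by omega) (by omega)]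
      | succ q =>
        have e := (@ih p q (by omega) (by omega)).1
        have h1 := (extendedCount_steps hy hb hyb (p := p) (q := q + 1) (by omega)).1
        have h2 := (extendedCount_steps hy hb hyb (p := p + 1) (q := q) (by omega)).1
        have h4 := (extendedCount_steps hy hb hyb (p := p) (q := q) (by omega)).1
        have h3 : extendedFilling n y b p q = _ := if_pos (by omega)
        rw [rowSum_succ, rowSum_succ]
        omega
    · cases p with
      | zero =>
        simp only [colSum_zero]
        repeat rw [extendedCount_zero hy hb hyb h0 hn (by omega) (by omega)]
      | succ p =>
        have e := (@ih p q (by omega) (by omega)).2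
        have h1 := (extendedCount_steps hy hb hyb (p := p) (q := q + 1) (by omega)).1
        have h2 := (extendedCount_steps hy hb hyb (p := p + 1) (q := q) (by omega)).1
        have h4 := (extendedCount_steps hy hb hyb (p := p) (q := q) (by omega)).1
        have h3 : extendedFilling n y b p q = _ := if_pos (by omega)
        rw [colSum_succ, colSum_succ]
        omega

lemma isPartialMatching_extendedFilling (h0 : b 0 = 0) (hn : b n = 0) :
    IsPartialMatching n (extendedFilling n y b) where
  support p q h := if_neg (by omega)
  coverage_le p hp := by
    have h1 := extendedFilling_sums hy hb hyb h0 hn (p := p) (q := n - 1 - p) (by omega)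
    have h2 := hb p hp
    have h3 := (extendedCount_steps hy hb hyb (p := p) (q := n - 1 - p) (by omega)).1
    have h5 := extendedCount_boundary (n := n) (y := y) (b := b) (p := p) (q := n - 1 - p + 1)
      (by omega)
    have h6 := extendedCount_boundary (n := n) (y := y) (b := b) (p := p + 1) (q := n - 1 - p)
      (by omega)
    have h7 := hy.support p (n - 1 - p) (by omega)
    unfold coverage Nat.dist at *
    omega

/-- Every compatible pair of a skeleton and boundary values comes from a filling. -/
lemma exists_skeleton_eq (h0 : b 0 = 0) (hn : b n = 0) :
    ∃ x, IsPartialMatching n x ∧ skeleton n x = y ∧ ∀ t ≤ n, shadowCount x t (n - t) = b t :=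
  ⟨extendedFilling n y b, isPartialMatching_extendedFilling hy hb hyb h0 hn,
    skeleton_extendedFilling hy hb hyb h0 hn, fun t ht => by
      rw [shadowCount_extendedFilling hy hb hyb h0 hn (by omega),
        extendedCount_boundary (by omega)]⟩

end extension

/-! ### Crossings and skeletons. -/

/-- A `k`-crossing of a filling: a chain of `k` nonzero cells with increasing rows and decreasing
columns, contained in a rectangle inside the triangle `p + q + 2 ≤ n`. -/
def FillingHasCrossing (n k : ℕ) (x : ℕ → ℕ → ℕ) : Prop :=
  ∃ i j : ℕ → ℕ, (∀ r < k, x (i r) (j r) ≠ 0) ∧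
    (∀ r s, r < s → s < k → i r < i s ∧ j s < j r) ∧ ∀ r < k, ∀ s < k, i r + j s + 2 ≤ n

namespace IsPartialMatching

variable {n : ℕ} {x : ℕ → ℕ → ℕ}

/-- A shadow line leaves `(p, q)` along its column and another leaves `(p', q')` along its row.
Unless a skeleton cell stops one of them earlier, they meet at `(p', q)`, which is then a skeleton
cell. -/
lemma exists_skeleton_between (hx : IsPartialMatching n x) {p q p' q' : ℕ} (h : x p q ≠ 0)
    (h' : x p' q' ≠ 0) (hp : p < p') (hq : q' < q) (hn : p' + q + 2 ≤ n) :
    ∃ i j, skeleton n x i j ≠ 0 ∧ p < i ∧ i ≤ p' ∧ q' < j ∧ j ≤ q := by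
  by_contra! hc
  have i1 := hx.shadowCount_increments (p := p') (q := q) (by omega)
  have c1 := hx.colSum_le (p := p') (q := q) (by omega)
  have r1 := hx.rowSum_le (p := p') (q := q) (by omega)
  have c2 := le_colSum x (q := q) hp
  have r2 := le_rowSum x (p := p') hq
  -- the column `q` has no skeleton cell above row `p`, and the row `p'` none left of column `q'`
  have c3 : colSum (skeleton n x) (p + 1) q = 0 := by
    have i2 := hx.shadowCount_increments (p := p + 1) (q := q) (by omega)
    have i3 := hx.shadowCount_increments (p := p) (q := q) (by omega)
    have r3 := hx.rowSum_le (p := p) (q := q + 1) (by omega)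
    have c4 := hx.colSum_le (p := p + 1) (q := q) (by omega)
    rw [colSum_succ] at c4 i2 ⊢
    rw [rowSum_succ] at r3
    have h7 : skeleton n x p q = _ := if_pos (by omega)
    omega
  have r3 : rowSum (skeleton n x) p' (q' + 1) = 0 := by
    have i2 := hx.shadowCount_increments (p := p') (q := q' + 1) (by omega)
    have i3 := hx.shadowCount_increments (p := p') (q := q') (by omega)
    have r4 := hx.rowSum_le (p := p') (q := q' + 1) (by omega)
    have c4 := hx.colSum_le (p := p' + 1) (q := q') (by omega)
    rw [rowSum_succ] at r4 i2 ⊢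
    rw [colSum_succ] at c4
    have h7 : skeleton n x p' q' = _ := if_pos (by omega)
    omega
  have c5 : colSum (skeleton n x) p' q = 0 := by
    by_contra h0
    obtain ⟨i, h1, h2, h3⟩ := exists_of_colSum_lt (skeleton n x) (p := p + 1) (r := p') (q := q)
      (by omega)
    have := hc i q h3 (by omega) (by omega) hq
    omega
  have r5 : rowSum (skeleton n x) p' q = 0 := by
    by_contra h0
    obtain ⟨j, h1, h2, h3⟩ := exists_of_rowSum_lt (skeleton n x) (p := p') (r := q) (q := q' + 1)
      (by omega)
    have := hc p' j h3 (by omega) (by omega) (by omega)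
    omega
  have h7 : skeleton n x p' q = _ := if_pos (by omega)
  have := hc p' q (by omega) hp le_rfl hq
  omega

/-- Otherwise the line reaching `(p, q)` along row `p` and the one reaching `(p', q')` along column
`q'` would both enter `(p, q')`. They would meet there and stop too early. -/
lemma exists_between_skeleton (hx : IsPartialMatching n x) {p q p' q' : ℕ}
    (h : skeleton n x p q ≠ 0) (h' : skeleton n x p' q' ≠ 0) (hp : p < p') (hq : q' < q)
    (hn : p' + q + 2 ≤ n) :
    ∃ i j, x i j ≠ 0 ∧ p ≤ i ∧ i < p' ∧ q' ≤ j ∧ j < q := by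
  by_contra! hc
  have r1 : rowSum x p q = rowSum x p q' := by
    by_contra h0
    have := rowSum_mono x p hq.le
    obtain ⟨j, h1, h2, h3⟩ := exists_of_rowSum_lt x (p := p) (r := q) (q := q') (by omega)
    have := hc p j h3 le_rfl hp h1
    omega
  have c1 : colSum x p' q' = colSum x p q' := by
    by_contra h0
    have := colSum_mono x q' hp.le
    simp only at this
    obtain ⟨i, h1, h2, h3⟩ := exists_of_colSum_lt x (p := p) (r := p') (q := q') (by omega)
    have := hc i q' h3 h1 h2 le_rfl
    omega
  have i1 := hx.shadowCount_increments (p := p) (q := q) (by omega)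
  have i2 := hx.shadowCount_increments (p := p') (q := q') (by omega)
  have i3 := hx.shadowCount_increments (p := p) (q := q') (by omega)
  have e1 : skeleton n x p q = _ := if_pos (by omega)
  have e2 : skeleton n x p' q' = _ := if_pos (by omega)
  have e3 : skeleton n x p q' = _ := if_pos (by omega)
  have r2 := hx.rowSum_le (p := p) (q := q) (by omega)
  have c2 := hx.colSum_le (p := p') (q := q') (by omega)
  have r3 := rowSum_mono (skeleton n x) p (Nat.succ_le_of_lt hq)
  have c3 := colSum_mono (skeleton n x) q' (Nat.succ_le_of_lt hp)
  simp only [Nat.succ_eq_add_one, rowSum_succ, colSum_succ] at r3 c3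
  omega

/-- Passing to the skeleton shortens the crossings by one. -/
lemma hasCrossing_skeleton_iff (hx : IsPartialMatching n x) (k : ℕ) :
    FillingHasCrossing n (k + 1) (skeleton n x) ↔ FillingHasCrossing n (k + 2) x := by
  constructor
  · rintro ⟨i, j, h1, h2, h3⟩
    -- The `k` gaps between consecutive skeleton cells give `k` cells. The other two are the origins
    -- of the line entering the first skeleton cell along its column and of the line entering the
    -- last one along its row. The bounds by `i k` and `j 0` keep the whole chain in a rectangle
    -- inside the triangle.
    have key : ∀ r, ∃ a b, r < k + 2 → x a b ≠ 0 ∧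
        (∀ s, r = s + 1 → i s ≤ a ∧ b < j s) ∧ (r < k + 1 → a < i r ∧ j r ≤ b) ∧
        a ≤ i k ∧ b ≤ j 0 := by
      intro r
      by_cases hr : r < k + 2
      swap
      · exact ⟨0, 0, fun h => absurd h hr⟩
      rcases Nat.eq_zero_or_pos r with rfl | hr0
      · have h4 := h1 0 (by omega)
        have h5 := h3 0 (by omega) 0 (by omega)
        have e1 : skeleton n x (i 0) (j 0) = _ := if_pos h5
        have i1 := hx.shadowCount_increments (p := i 0) (q := j 0) (by omega)
        obtain ⟨a, -, ha, ha'⟩ := exists_of_colSum_lt x (p := 0) (r := i 0) (q := j 0) (by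
          rw [colSum_zero]; omega)
        refine ⟨a, j 0, fun _ => ⟨ha', fun s hs => by omega, fun _ => ⟨ha, le_rfl⟩, ?_, le_rfl⟩⟩
        rcases Nat.eq_zero_or_pos k with rfl | hk
        · exact ha.le
        · have := h2 0 k hk (by omega)
          omega
      obtain ⟨r, rfl⟩ : ∃ s, r = s + 1 := ⟨r - 1, by omega⟩
      by_cases hrk : r < k
      · have h4 := h2 r (r + 1) (by omega) (by omega)
        obtain ⟨a, b, hab, g1, g2, g3, g4⟩ := hx.exists_between_skeleton (h1 r (by omega))
          (h1 (r + 1) (by omega)) h4.1 h4.2 (h3 _ (by omega) _ (by omega))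
        refine ⟨a, b, fun _ => ⟨hab, fun s hs => ?_, fun _ => ⟨g2, g3⟩, ?_, ?_⟩⟩
        · obtain rfl : r = s := by omega
          exact ⟨g1, g4⟩
        · rcases Nat.lt_or_ge (r + 1) k with h5 | h5
          · have := h2 (r + 1) k h5 (by omega)
            omega
          · rw [show k = r + 1 by omega]
            exact g2.le
        · rcases Nat.eq_zero_or_pos r with rfl | h5
          · exact g4.le
          · have := h2 0 r h5 (by omega)
            omega
      · obtain rfl : r = k := by omega
        have h4 := h1 r (by omega)
        have h5 := h3 r (by omega) r (by omega)
        have e1 : skeleton n x (i r) (j r) = _ := if_pos h5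
        have i1 := hx.shadowCount_increments (p := i r) (q := j r) (by omega)
        obtain ⟨b, -, hb, hb'⟩ := exists_of_rowSum_lt x (p := i r) (r := j r) (q := 0) (by
          rw [rowSum_zero]; omega)
        refine ⟨i r, b, fun _ => ⟨hb', fun s hs => ?_, fun _ => by omega, le_rfl, ?_⟩⟩
        · obtain rfl : r = s := by omega
          exact ⟨le_rfl, hb⟩
        · rcases Nat.eq_zero_or_pos r with rfl | h5
          · exact hb.le
          · have := h2 0 r h5 (by omega)
            omega
    choose a b hab using key
    refine ⟨a, b, fun r hr => (hab r hr).1, fun r s hrs hs => ?_, fun r hr s hs => ?_⟩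
    · obtain ⟨s, rfl⟩ : ∃ t, s = t + 1 := ⟨s - 1, by omega⟩
      have g1 := (hab r (by omega)).2.2.1 (by omega)
      have g2 := (hab (s + 1) hs).2.1 s rfl
      rcases Nat.lt_or_ge r s with h4 | h4
      · have := h2 r s h4 (by omega)
        omega
      · obtain rfl : r = s := by omega
        omega
    · have g1 := (hab r hr).2.2.2
      have g2 := (hab s hs).2.2.2
      have := h3 k (by omega) 0 (by omega)
      omega
  · rintro ⟨i, j, h1, h2, h3⟩
    have key : ∀ r, ∃ a b, r < k + 1 → skeleton n x a b ≠ 0 ∧ i r < a ∧ a ≤ i (r + 1) ∧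
        j (r + 1) < b ∧ b ≤ j r := by
      intro r
      by_cases hr : r < k + 1
      · have h4 := h2 r (r + 1) (by omega) (by omega)
        obtain ⟨a, b, h⟩ := hx.exists_skeleton_between (h1 r (by omega)) (h1 (r + 1) (by omega))
          h4.1 h4.2 (h3 _ (by omega) _ (by omega))
        exact ⟨a, b, fun _ => h⟩
      · exact ⟨0, 0, fun h => absurd h hr⟩
    choose a b hab using key
    refine ⟨a, b, fun r hr => (hab r hr).1, fun r s hrs hs => ?_, fun r hr s hs => ?_⟩
    · have g1 := hab r (by omega)
      have g2 := hab s hs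
      rcases Nat.lt_or_ge (r + 1) s with h4 | h4
      · have := h2 (r + 1) s h4 (by omega)
        omega
      · obtain rfl : s = r + 1 := by omega
        omega
    · have g1 := hab r hr
      have g2 := hab s hs
      have := h3 (r + 1) (by omega) s (by omega)
      omega

/-- A filling has no `(d + 1)`-crossing if and only if its `d`-th skeleton is empty. -/
lemma not_hasCrossing_iff (hx : IsPartialMatching n x) (d : ℕ) :
    ¬ FillingHasCrossing n (d + 1) x ↔ (skeleton n)^[d] x = 0 := by
  induction d generalizing x with
  | zero =>
    rw [Function.iterate_zero, id, not_iff_comm]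
    constructor
    · intro h
      obtain ⟨p, q, hpq⟩ : ∃ p q, x p q ≠ 0 := by
        by_contra! hc
        exact h (funext fun p => funext fun q => hc p q)
      refine ⟨fun _ => p, fun _ => q, fun _ _ => hpq, fun r s h1 h2 => by omega, fun _ _ _ _ => ?_⟩
      by_contra h2
      exact hpq (hx.support p q (not_le.1 h2))
    · rintro ⟨i, j, h1, -⟩ rfl
      exact h1 0 (by omega) rfl
  | succ d ih =>
    rw [Function.iterate_succ_apply, ← ih hx.isPartialMatching_skeleton,
      hx.hasCrossing_skeleton_iff]

end IsPartialMatching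

/-! ### Iterated skeletons and lattice walks. -/

namespace IsPartialMatching

variable {n : ℕ} {x y : ℕ → ℕ → ℕ}

lemma eq_of_walks_eq (hx : IsPartialMatching n x) (hy : IsPartialMatching n y) (d : ℕ)
    (hxy : (skeleton n)^[d] x = (skeleton n)^[d] y)
    (h : ∀ r < d, ∀ t ≤ n, shadowCount ((skeleton n)^[r] x) t (n - t) =
      shadowCount ((skeleton n)^[r] y) t (n - t)) : x = y := by
  induction d generalizing x y with
  | zero => exact hxy
  | succ d ih =>
    exact hx.eq_of_skeleton_eq hy
      (ih hx.isPartialMatching_skeleton hy.isPartialMatching_skeleton hxy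
        fun r hr t ht => h (r + 1) (by omega) t ht)
      (h 0 (by omega))

/-- Iterating `coverage_eq`: the left side is the `ℓ¹`-length of a step of the walk once the `d`-th
skeleton is empty. -/
lemma coverage_eq_sum (hx : IsPartialMatching n x) (d : ℕ) {p : ℕ} (hp : p < n) :
    coverage n x p = coverage n ((skeleton n)^[d] x) p +
      ∑ r ∈ Finset.range d, Nat.dist (shadowCount ((skeleton n)^[r] x) p (n - p))
        (shadowCount ((skeleton n)^[r] x) (p + 1) (n - (p + 1))) := by
  induction d with
  | zero => simp
  | succ d ih =>
    rw [ih, (hx.isPartialMatching_iterate_skeleton d).coverage_eq hp, Finset.sum_range_succ,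
      Function.iterate_succ_apply']
    ring

end IsPartialMatching

@[simp] lemma shadowCount_zero (p q : ℕ) : shadowCount 0 p q = 0 := by
  induction p generalizing q with
  | zero => simp
  | succ p ihp =>
    induction q with
    | zero => simp
    | succ q ihq => simp [shadowCount_succ, ihp, ihq]

@[simp] lemma coverage_zero (n p : ℕ) : coverage n 0 p = 0 := by
  simp [coverage, rowSum, colSum]

lemma isPartialMatching_zero (n : ℕ) : IsPartialMatching n 0 where
  support _ _ _ := rfl
  coverage_le p _ := by simp

/-- Every lattice walk in the chamber comes from a filling. -/
lemma exists_filling_of_walk (n d : ℕ) (w : ℕ → ℕ → ℕ) (h0 : ∀ r < d, w r 0 = 0)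
    (hn : ∀ r < d, w r n = 0) (hw : ∀ r, r + 1 < d → ∀ t ≤ n, w (r + 1) t ≤ w r t)
    (hs : ∀ p < n, ∑ r ∈ Finset.range d, Nat.dist (w r p) (w r (p + 1)) ≤ 1) :
    ∃ x, IsPartialMatching n x ∧ (skeleton n)^[d] x = 0 ∧
      ∀ r < d, ∀ t ≤ n, shadowCount ((skeleton n)^[r] x) t (n - t) = w r t := by
  induction d generalizing w with
  | zero => exact ⟨0, isPartialMatching_zero n, rfl, fun r hr => by omega⟩
  | succ d ih =>
    -- Coordinate `0` is split off as the boundary values `w 0`; the others produce the skeleton `y`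
    -- by induction. The step bound and the chamber inequality `w 1 ≤ w 0` are the compatibility
    -- conditions for `exists_skeleton_eq`.
    simp only [Finset.sum_range_succ'] at hs
    obtain ⟨y, hy, hyd, hyw⟩ := ih (fun r => w (r + 1)) (fun r hr => h0 _ (by omega))
      (fun r hr => hn _ (by omega)) (fun r hr => hw _ (by omega))
      (fun p hp => by have := hs p hp; omega)
    obtain ⟨x, hx, rfl, hxb⟩ := exists_skeleton_eq (b := w 0) hy
      (fun p hp => by
        have e := hy.coverage_eq_sum d hp
        rw [hyd, coverage_zero, zero_add, Finset.sum_congr rfl (g := fun r =>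
          Nat.dist (w (r + 1) p) (w (r + 1) (p + 1))) fun r hr => by
            rw [hyw r (Finset.mem_range.1 hr) p (by omega),
              hyw r (Finset.mem_range.1 hr) (p + 1) (by omega)]] at e
        have := hs p hp
        omega)
      (fun t ht => by
        rcases Nat.eq_zero_or_pos d with rfl | hd
        · rw [Function.iterate_zero, id] at hyd
          simp [hyd]
        · have h1 := hyw 0 hd t ht
          have h2 := hw 0 (by omega) t ht
          simp only [Function.iterate_zero, id] at h1
          omega)
      (h0 0 (by omega)) (hn 0 (by omega))
    refine ⟨x, hx, hyd, fun r hr t ht => ?_⟩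
    cases r with
    | zero => exact hxb t ht
    | succ r => exact hyw r (by omega) t ht

/-- The fillings that encode the complete matchings of `n` points without `k`-crossings. -/
def noncrossingFillings (k n : ℕ) : Set (ℕ → ℕ → ℕ) :=
  {x | IsPartialMatching n x ∧ (∀ p < n, coverage n x p = 1) ∧ ¬ FillingHasCrossing n k x}

/-- The lattice walk read off the boundary shadow counts of the iterated skeletons. -/
def fillingWalk (n d : ℕ) (x : ℕ → ℕ → ℕ) (t : Fin (n + 1)) (r : Fin d) : ℤ :=
  shadowCount ((skeleton n)^[r] x) t (n - t)

lemma isUnitStep_iff {d : ℕ} (v : Fin d → ℤ) : IsUnitStep v ↔ ∑ r, (v r).natAbs = 1 := by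
  constructor
  · rintro ⟨c, rfl | rfl⟩
    · rw [Finset.sum_eq_single c] <;> simp +contextual
    · rw [Finset.sum_eq_single c] <;> simp +contextual
  · intro h
    obtain ⟨c, -, hc⟩ : ∃ c ∈ Finset.univ, (v c).natAbs ≠ 0 := by
      by_contra! hc
      rw [Finset.sum_eq_zero hc] at h
      omega
    rw [← Finset.add_sum_erase _ _ (Finset.mem_univ c)] at h
    have h0 : ∀ r ≠ c, v r = 0 := fun r hr => by
      have := (Finset.sum_eq_zero_iff (s := Finset.univ.erase c)
        (f := fun r => (v r).natAbs)).1 (by omega) r (by simp [hr])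
      omega
    refine ⟨c, ?_⟩
    have h1 : v c = 1 ∨ v c = -1 := by omega
    refine h1.imp (fun h1 => ?_) fun h1 => ?_
    all_goals
      funext r
      by_cases hr : r = c
      · subst hr; simp [h1]
      · simp [h0 r hr, hr]

lemma natAbs_sub_eq_dist (a b : ℕ) : ((b : ℤ) - a).natAbs = Nat.dist a b := by
  unfold Nat.dist
  omega

lemma fillingWalk_mem {n d : ℕ} {x : ℕ → ℕ → ℕ} (hx : x ∈ noncrossingFillings (d + 1) n) :
    fillingWalk n d x ∈ closedChamberWalks d n := by
  obtain ⟨hx, hc, hk⟩ := hx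
  rw [hx.not_hasCrossing_iff] at hk
  refine ⟨?_, ?_, fun t => ⟨?_, fun r => ?_⟩, fun t => ?_⟩
  · funext r
    simp [fillingWalk]
  · funext r
    simp [fillingWalk]
  · cases d with
    | zero => exact fun r => r.elim0
    | succ d =>
      refine Fin.antitone_iff_succ_le.2 fun r => ?_
      simp only [fillingWalk, Fin.val_succ, Fin.val_castSucc, Function.iterate_succ_apply']
      exact_mod_cast (hx.isPartialMatching_iterate_skeleton r).shadowCount_skeleton_le
        (by have := t.2; omega)
  · exact Int.natCast_nonneg _
  · rw [isUnitStep_iff]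
    have h := hx.coverage_eq_sum d t.2
    rw [hc t t.2, hk, coverage_zero, zero_add, Finset.sum_range] at h
    rw [h]
    refine Finset.sum_congr rfl fun r _ => ?_
    simp only [Pi.sub_apply, fillingWalk, Fin.val_succ, Fin.val_castSucc, natAbs_sub_eq_dist]

lemma fillingWalk_bijOn (n d : ℕ) :
    Set.BijOn (fillingWalk n d) (noncrossingFillings (d + 1) n) (closedChamberWalks d n) := by
  refine ⟨fun x hx => fillingWalk_mem hx, ?_, ?_⟩
  · rintro x ⟨hx, -, hxk⟩ y ⟨hy, -, hyk⟩ hxy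
    rw [hx.not_hasCrossing_iff] at hxk
    rw [hy.not_hasCrossing_iff] at hyk
    refine hx.eq_of_walks_eq hy d (hxk.trans hyk.symm) fun r hr t ht => ?_
    have := congrFun (congrFun hxy ⟨t, by omega⟩) ⟨r, hr⟩
    simpa [fillingWalk] using this
  · rintro v ⟨hv0, hvn, hvc, hvs⟩
    let w : ℕ → ℕ → ℕ := fun r t =>
      if h : r < d ∧ t < n + 1 then (v ⟨t, h.2⟩ ⟨r, h.1⟩).toNat else 0
    have hw : ∀ (t : Fin (n + 1)) (r : Fin d), (w r t : ℤ) = v t r := fun t r => by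
      have := (hvc t).2 r
      simp only [w, r.2, t.2, and_self, dite_true, Fin.eta]
      omega
    have hwd : ∀ t : Fin n, ∑ r ∈ Finset.range d, Nat.dist (w r t) (w r (t + 1)) = 1 := fun t => by
      refine Eq.trans ?_ ((isUnitStep_iff _).1 (hvs t))
      rw [Finset.sum_range]
      refine Finset.sum_congr rfl fun r _ => ?_
      rw [Pi.sub_apply, ← hw, ← hw, natAbs_sub_eq_dist]
      rfl
    obtain ⟨x, hx, hxd, hxw⟩ := exists_filling_of_walk n d w
      (fun r hr => by
        have := hw 0 ⟨r, hr⟩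
        rw [hv0] at this
        exact Int.ofNat_eq_zero.1 this)
      (fun r hr => by
        have := hw (Fin.last n) ⟨r, hr⟩
        rw [hvn] at this
        exact Int.ofNat_eq_zero.1 this)
      (fun r hr t ht => by
        have h1 := hw ⟨t, by omega⟩ ⟨r, by omega⟩
        have h2 := hw ⟨t, by omega⟩ ⟨r + 1, hr⟩
        have h3 := (hvc ⟨t, by omega⟩).1 (show (⟨r, by omega⟩ : Fin d) ≤ ⟨r + 1, hr⟩ by
          simp [Fin.le_def])
        simp only at h1 h2
        omega)
      (fun p hp => (hwd ⟨p, hp⟩).le)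
    refine ⟨x, ⟨hx, fun p hp => ?_, by rwa [hx.not_hasCrossing_iff]⟩, ?_⟩
    · rw [hx.coverage_eq_sum d hp, hxd, coverage_zero, zero_add]
      refine Eq.trans ?_ (hwd ⟨p, hp⟩)
      refine Finset.sum_congr rfl fun r hr => ?_
      rw [hxw r (Finset.mem_range.1 hr) p (by omega),
        hxw r (Finset.mem_range.1 hr) (p + 1) (by omega)]
    · funext t r
      rw [fillingWalk, hxw r r.2 t (by have := t.2; omega), hw]

/-! ### Matchings as fillings of the triangle. -/

open Classical in
/-- The filling of a matching: the arc `(i, j)` becomes the cell `(i - 1, n - j)`. -/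
noncomputable def matchingFilling {n : ℕ} (M : Finpartition (Finset.Icc 1 n)) (p q : ℕ) : ℕ :=
  if IsArc M (p + 1) (n - q) then 1 else 0

lemma matchingFilling_ne_zero_iff {n : ℕ} {M : Finpartition (Finset.Icc 1 n)} {p q : ℕ} :
    matchingFilling M p q ≠ 0 ↔ IsArc M (p + 1) (n - q) := by
  simp [matchingFilling]

namespace IsArc

variable {n : ℕ} {M : Finpartition (Finset.Icc 1 n)} {i j i' j' : ℕ}

lemma one_le (h : IsArc M i j) : 1 ≤ i :=
  (Finset.mem_Icc.1 (M.le h.2 (by simp : i ∈ ({i, j} : Finset ℕ)))).1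

lemma le (h : IsArc M i j) : j ≤ n :=
  (Finset.mem_Icc.1 (M.le h.2 (by simp : j ∈ ({i, j} : Finset ℕ)))).2

lemma matchingFilling_ne_zero (h : IsArc M i j) : matchingFilling M (i - 1) (n - j) ≠ 0 := by
  rw [matchingFilling_ne_zero_iff, Nat.sub_add_cancel h.one_le, Nat.sub_sub_self h.le]
  exact h

/-- Arcs that share an endpoint are equal. -/
lemma eq_of_mem (h : IsArc M i j) (h' : IsArc M i' j') {a : ℕ} (ha : a = i ∨ a = j)
    (ha' : a = i' ∨ a = j') : i = i' ∧ j = j' := by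
  have e := M.eq_of_mem_parts h.2 h'.2 (a := a) (by simpa using ha) (by simpa using ha')
  have h1 : i ∈ ({i', j'} : Finset ℕ) := e ▸ by simp
  have h2 : j ∈ ({i', j'} : Finset ℕ) := e ▸ by simp
  have h3 := h.1
  have h4 := h'.1
  simp only [Finset.mem_insert, Finset.mem_singleton] at h1 h2
  omega

end IsArc

section matchings

variable {n : ℕ} {M : Finpartition (Finset.Icc 1 n)}

lemma exists_isArc_of_mem_parts (hM : M ∈ completeMatchings n) {B : Finset ℕ} (hB : B ∈ M.parts) :
    ∃ i j, IsArc M i j ∧ B = {i, j} := by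
  obtain ⟨i, j, hij, rfl⟩ := Finset.card_eq_two.1 (hM B hB)
  rcases hij.lt_or_gt with h | h
  · exact ⟨i, j, ⟨h, hB⟩, rfl⟩
  · exact ⟨j, i, ⟨h, Finset.pair_comm i j ▸ hB⟩, Finset.pair_comm i j⟩

lemma matchingFilling_support (p q : ℕ) (h : n < p + q + 2) : matchingFilling M p q = 0 := by
  by_contra h0
  have := (matchingFilling_ne_zero_iff.1 h0).1
  omega

lemma coverage_matchingFilling (hM : M ∈ completeMatchings n) {p : ℕ} (hp : p < n) :
    coverage n (matchingFilling M) p = 1 := by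
  obtain ⟨B, hB, hpB⟩ := M.exists_mem (a := p + 1) (by simp; omega)
  obtain ⟨i, j, hij, rfl⟩ := exists_isArc_of_mem_parts hM hB
  have h1 := hij.one_le
  have h2 := hij.le
  have h3 := hij.1
  have hone : matchingFilling M (i - 1) (n - j) = 1 := by
    rw [matchingFilling, if_pos]
    rw [Nat.sub_add_cancel h1, Nat.sub_sub_self h2]
    exact hij
  have hrow : ∀ q, matchingFilling M p q ≠ 0 → i = p + 1 ∧ j = n - q := fun q hq =>
    hij.eq_of_mem (matchingFilling_ne_zero_iff.1 hq) (a := p + 1) (by simpa using hpB)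
      (Or.inl rfl)
  -- Column `n - 1 - p` holds the arcs whose right endpoint is `p + 1`.
  have hcol : ∀ p', matchingFilling M p' (n - 1 - p) ≠ 0 → i = p' + 1 ∧ j = p + 1 :=
    fun p' hp' => by
      have := hij.eq_of_mem (matchingFilling_ne_zero_iff.1 hp') (a := p + 1) (by simpa using hpB)
        (Or.inr (by omega))
      omega
  simp only [Finset.mem_insert, Finset.mem_singleton] at hpB
  rcases hpB with h | h
  · have r : rowSum (matchingFilling M) p (n - 1 - p) = 1 := by
      rw [rowSum, Finset.sum_eq_single (n - j), ← hone, ← h, Nat.add_sub_cancel]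
      · intro q hq hqj
        by_contra h0
        have := hrow q h0
        rw [Finset.mem_range] at hq
        omega
      · intro hq
        rw [Finset.mem_range] at hq
        omega
    have c : colSum (matchingFilling M) p (n - 1 - p) = 0 := by
      refine Finset.sum_eq_zero fun p' _ => ?_
      by_contra h0
      have := hcol p' h0
      omega
    rw [coverage, r, c]
  · have r : rowSum (matchingFilling M) p (n - 1 - p) = 0 := by
      refine Finset.sum_eq_zero fun q _ => ?_
      by_contra h0
      have := hrow q h0
      omega
    have c : colSum (matchingFilling M) p (n - 1 - p) = 1 := by
      rw [colSum, Finset.sum_eq_single (i - 1)]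
      · rwa [show n - 1 - p = n - j by omega]
      · intro p' hp' hi
        by_contra h0
        have := hcol p' h0
        omega
      · intro hq
        rw [Finset.mem_range] at hq
        omega
    rw [coverage, r, c]

lemma fillingHasCrossing_matchingFilling_iff (k : ℕ) :
    FillingHasCrossing n k (matchingFilling M) ↔ HasCrossing k M := by
  constructor
  · rintro ⟨i, j, h1, h2, h3⟩
    refine ⟨fun r => i r + 1, fun r => n - j r, fun r => matchingFilling_ne_zero_iff.1 (h1 r r.2),
      fun r s hrs => ?_, fun r s hrs => ?_, fun r s => ?_⟩
    · have := h2 r s hrs s.2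
      simp only
      omega
    · have := h2 r s hrs s.2
      have := h3 r r.2 r r.2
      simp only
      omega
    · have := h3 r r.2 s s.2
      simp only
      omega
  · rintro ⟨i, j, h1, h2, h3, h4⟩
    refine ⟨fun r => if h : r < k then i ⟨r, h⟩ - 1 else 0,
      fun r => if h : r < k then n - j ⟨r, h⟩ else 0, fun r hr => ?_, fun r s hrs hs => ?_,
      fun r hr s hs => ?_⟩
    · simpa only [hr, dite_true] using (h1 ⟨r, hr⟩).matchingFilling_ne_zero
    · have hr : r < k := hrs.trans hs
      have g1 := h2 (a := ⟨r, hr⟩) (b := ⟨s, hs⟩) hrs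
      have g2 := h3 (a := ⟨r, hr⟩) (b := ⟨s, hs⟩) hrs
      have g3 := (h1 ⟨r, hr⟩).one_le
      have g4 := (h1 ⟨s, hs⟩).le
      simp only [hr, hs, dite_true]
      omega
    · have g1 := h4 ⟨r, hr⟩ ⟨s, hs⟩
      have g3 := (h1 ⟨r, hr⟩).one_le
      have g4 := (h1 ⟨s, hs⟩).le
      simp only [hr, hs, dite_true]
      omega

lemma matchingFilling_mem {k : ℕ} (hM : M ∈ noncrossingMatchings k n) :
    matchingFilling M ∈ noncrossingFillings k n :=
  ⟨⟨matchingFilling_support, fun _ hp => (coverage_matchingFilling hM.1 hp).le⟩,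
    fun _ hp => coverage_matchingFilling hM.1 hp,
    fun h => hM.2 ((fillingHasCrossing_matchingFilling_iff k).1 h)⟩

lemma parts_subset_of_matchingFilling_eq {M' : Finpartition (Finset.Icc 1 n)}
    (hM : M ∈ completeMatchings n) (h : matchingFilling M = matchingFilling M') :
    M.parts ⊆ M'.parts := by
  intro B hB
  obtain ⟨i, j, hij, rfl⟩ := exists_isArc_of_mem_parts hM hB
  have h1 := hij.matchingFilling_ne_zero
  rw [h, matchingFilling_ne_zero_iff, Nat.sub_add_cancel hij.one_le,
    Nat.sub_sub_self hij.le] at h1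
  exact h1.2

end matchings

namespace IsPartialMatching

variable {n : ℕ} {x : ℕ → ℕ → ℕ}

/-- Cells of a partial matching that share an endpoint are equal. -/
lemma cell_eq (hx : IsPartialMatching n x) {p q p' q' a : ℕ} (h : x p q ≠ 0) (h' : x p' q' ≠ 0)
    (ha : a = p + 1 ∨ a = n - q) (ha' : a = p' + 1 ∨ a = n - q') : p = p' ∧ q = q' := by
  have hs : p + q + 2 ≤ n := not_lt.1 fun hs => h (hx.support p q hs)
  have hs' : p' + q' + 2 ≤ n := not_lt.1 fun hs => h' (hx.support p' q' hs)
  have row : ∀ {p q q'}, x p q ≠ 0 → x p q' ≠ 0 → p + q' + 2 ≤ n → ¬ q < q' := by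
    intro p q q' h h' hs hlt
    have h1 := le_rowSum x (p := p) hlt
    have h2 := hx.rowSum_le (p := p) (q := q' + 1) (by omega)
    rw [rowSum_succ] at h2
    omega
  have col : ∀ {p p' q}, x p q ≠ 0 → x p' q ≠ 0 → p' + q + 2 ≤ n → ¬ p < p' := by
    intro p p' q h h' hs hlt
    have h1 := le_colSum x (q := q) hlt
    have h2 := hx.colSum_le (p := p' + 1) (q := q) (by omega)
    rw [colSum_succ] at h2
    omega
  -- A point cannot both open and close an arc: its row and its column are counted in the same
  -- coverage.
  have mixed : ∀ {p q p' q'}, x p q ≠ 0 → x p' q' ≠ 0 → p + q + 2 ≤ n → p' + q' + 2 ≤ n →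
      p + 1 ≠ n - q' := by
    intro p q p' q' h h' hs hs' he
    have h1 := le_rowSum x (p := p) (q := q) (r := n - 1 - p) (by omega)
    have h2 := le_colSum x (q := q') (p := p') (r := n - 1 - q') (by omega)
    have h3 := hx.coverage_le p (by omega)
    unfold coverage at h3
    rw [show n - 1 - q' = p by omega] at h2
    rw [show n - 1 - p = q' by omega] at h1 h3
    omega
  rcases ha with rfl | rfl <;> rcases ha' with ha | ha
  · obtain rfl : p = p' := by omega
    have := row h h' hs'
    have := row h' h hs
    omega
  · exact absurd ha (mixed h h' hs hs')
  · exact absurd ha.symm (mixed h' h hs' hs)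
  · obtain rfl : q = q' := by omega
    have := col h h' hs'
    have := col h' h hs
    omega

lemma exists_cell (hc : ∀ p < n, coverage n x p = 1) {a : ℕ} (ha : a ∈ Finset.Icc 1 n) :
    ∃ p q, x p q ≠ 0 ∧ (a = p + 1 ∨ a = n - q) := by
  rw [Finset.mem_Icc] at ha
  have h := hc (a - 1) (by omega)
  by_cases hr : rowSum x (a - 1) (n - 1 - (a - 1)) = 0
  · have hcs : 0 < colSum x (a - 1) (n - 1 - (a - 1)) := by
      unfold coverage at h
      omega
    obtain ⟨p, -, hp, h0⟩ := exists_of_colSum_lt x (p := 0) hcs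
    exact ⟨p, _, h0, Or.inr (by omega)⟩
  · obtain ⟨q, -, hq, h0⟩ := exists_of_rowSum_lt x (q := 0) (Nat.pos_of_ne_zero hr)
    exact ⟨_, q, h0, Or.inl (by omega)⟩

lemma exists_matchingFilling_eq (hx : IsPartialMatching n x)
    (hc : ∀ p < n, coverage n x p = 1) : ∃ M ∈ completeMatchings n, matchingFilling M = x := by
  classical
  have hs : ∀ {p q}, x p q ≠ 0 → p + q + 2 ≤ n := fun {p q} h =>
    not_lt.1 fun hs => h (hx.support p q hs)
  let P : Finset (Finset ℕ) := ((Finset.range n ×ˢ Finset.range n).filter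
    fun c => x c.1 c.2 ≠ 0).image fun c => {c.1 + 1, n - c.2}
  have hP : ∀ B, B ∈ P ↔ ∃ p q, x p q ≠ 0 ∧ B = {p + 1, n - q} := by
    intro B
    simp only [P, Finset.mem_image, Finset.mem_filter, Finset.mem_product, Finset.mem_range,
      Prod.exists]
    constructor
    · rintro ⟨p, q, ⟨-, h⟩, rfl⟩
      exact ⟨p, q, h, rfl⟩
    · rintro ⟨p, q, h, rfl⟩
      have := hs h
      exact ⟨p, q, ⟨by omega, h⟩, rfl⟩
  let M : Finpartition (Finset.Icc 1 n) := Finpartition.ofExistsUnique P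
    (fun B hB => by
      obtain ⟨p, q, h, rfl⟩ := (hP B).1 hB
      have := hs h
      intro a ha
      simp only [Finset.mem_insert, Finset.mem_singleton] at ha
      rw [Finset.mem_Icc]
      omega)
    (fun a ha => by
      obtain ⟨p, q, h, hpq⟩ := exists_cell hc ha
      refine ⟨{p + 1, n - q}, ⟨(hP _).2 ⟨p, q, h, rfl⟩, by simpa using hpq⟩, ?_⟩
      rintro B ⟨hB, haB⟩
      obtain ⟨p', q', h', rfl⟩ := (hP B).1 hB
      obtain ⟨rfl, rfl⟩ := hx.cell_eq h h' hpq (by simpa using haB)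
      rfl)
    (fun h => by
      obtain ⟨p, q, -, h⟩ := (hP _).1 h
      exact absurd h.symm (Finset.insert_ne_empty _ _))
  have hM : ∀ B, B ∈ M.parts ↔ ∃ p q, x p q ≠ 0 ∧ B = {p + 1, n - q} := hP
  refine ⟨M, fun B hB => ?_, ?_⟩
  · obtain ⟨p, q, h, rfl⟩ := (hM B).1 hB
    have := hs h
    exact Finset.card_pair (by omega)
  · have key : ∀ p q, matchingFilling M p q ≠ 0 ↔ x p q ≠ 0 := by
      intro p q
      rw [matchingFilling_ne_zero_iff]
      constructor
      · intro h
        obtain ⟨p', q', h', e⟩ := (hM _).1 h.2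
        have h1 := hs h'
        have h2 : IsArc M (p' + 1) (n - q') := ⟨by omega, (hM _).2 ⟨p', q', h', rfl⟩⟩
        have h3 := h.eq_of_mem h2 (a := p + 1) (Or.inl rfl) (by
          have : p + 1 ∈ ({p' + 1, n - q'} : Finset ℕ) := e ▸ by simp
          simpa using this)
        have h4 := h.1
        obtain ⟨rfl, rfl⟩ : p = p' ∧ q = q' := by omega
        exact h'
      · intro h
        have := hs h
        exact ⟨by omega, (hM _).2 ⟨p, q, h, rfl⟩⟩
    funext p q
    by_cases h : x p q = 0
    · rw [h]
      by_contra h0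
      exact (key p q).1 h0 h
    · have h1 := hs h
      have h2 := hx.rowSum_le (p := p) (q := q + 1) (by omega)
      have h3 := le_rowSum x (p := p) (Nat.lt_succ_self q)
      have h4 := (key p q).2 h
      unfold matchingFilling at h4 ⊢
      split_ifs at h4 ⊢
      · rw [Nat.succ_eq_add_one] at h3
        omega
      · exact absurd rfl h4

end IsPartialMatching

lemma matchingFilling_bijOn (k n : ℕ) :
    Set.BijOn matchingFilling (noncrossingMatchings k n) (noncrossingFillings k n) := by
  refine ⟨fun M hM => matchingFilling_mem hM, fun M hM M' hM' h => ?_, ?_⟩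
  · exact Finpartition.ext ((parts_subset_of_matchingFilling_eq hM.1 h).antisymm
      (parts_subset_of_matchingFilling_eq hM'.1 h.symm))
  · rintro x ⟨hx, hc, hk⟩
    obtain ⟨M, hM, rfl⟩ := hx.exists_matchingFilling_eq hc
    exact ⟨M, ⟨hM, fun h => hk ((fillingHasCrossing_matchingFilling_iff k).2 h)⟩, rfl⟩

/-- The `k`-noncrossing matchings of `[2m]` are equinumerous with the closed lattice walks of
length `2m` in the chamber of `ℤ^(k-1)`. -/
theorem corollary5p1 (k m : ℕ) (hk : 2 ≤ k) :
    (noncrossingMatchings k (2 * m)).encard = (closedChamberWalks (k - 1) (2 * m)).encard := by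
  obtain ⟨d, rfl⟩ : ∃ d, k = d + 1 := ⟨k - 1, by omega⟩
  have h := (fillingWalk_bijOn (2 * m) d).comp (matchingFilling_bijOn (d + 1) (2 * m))
  rw [Nat.add_sub_cancel, ← h.image_eq, h.injOn.encard_image]
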